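/- Let $q\ge 1$ and $R\ge 0$ be fixed integers, and let $V_q(\ell,R)=\sum_{i=0}^{R}\binom{\ell}{i}(q-1)^i$ be the size of a Hamming ball of radius $R$ in the space of words of length $\ell$ over an alphabet of size $q$. An $M\times N$ $(m,n,R)$-de Bruijn covering array is a doubly periodic $M\times N$ array (rows indexed modulo $M$, columns modulo $N$) over an alphabet of size $q$ such that every $m\times n$ array over the alphabet is within Hamming distance $R$ of at least one of the $MN$ (cyclic) $m\times n$ windows of the array. Then there is a constant $C>0$, depending only on $q$ and $R$, such that for all integers $m,n\ge 1$ and every integer $M\ge m$ there exist an integer $N\ge n$ and an $M\times N$ $(m,n,R)$-de Bruijn covering array whose area satisfies $$MN\;\le\; C\cdot\max\left\{\frac{q^{mn}}{V_q(mn,R)}\,(\log m+\log n),\; Mn\right\}.$$ In particular, $MN=O\!\left(\frac{q^{mn}}{V_q(mn,R)}(\log m+\log n)\right)$ for all $M\ge m$ for which $Mn=O\!\left(\frac{q^{mn}}{V_q(mn,R)}(\log m+\log n)\right)$, i.e. whenever $M$ rows and at least $n$ columns are compatible with such an area at all. -/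

import Mathlib

/-- The size of a ball of radius `R` in the Hamming space of words of length `n` over an alphabet
of size `q` (with `1 ≤ q`). -/
def ballVolume (q n R : ℕ) : ℕ :=
  ∑ i ∈ Finset.range (R + 1), n.choose i * (q - 1) ^ i

/-- A set `C` of words over `α`, with positions indexed by `ι`, is a covering code of radius `R` if
the Hamming balls of radius `R` around the words of `C` cover the whole space of words. -/
def IsCoveringCode {ι α : Type*} [Fintype ι] [DecidableEq α] (C : Set (ι → α)) (R : ℕ) : Prop :=
  ∀ w : ι → α, ∃ c ∈ C, hammingDist w c ≤ R

/-- The `m × n` window, with upper-left corner `(i, j)`, of a doubly periodic `M × N` array. The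
rows are indexed modulo `M` and the columns modulo `N`, so that windows wrap around. -/
def arrayWindow {M N : ℕ} {α : Type*} (A : ZMod M → ZMod N → α) (m n : ℕ)
    (i : ZMod M) (j : ZMod N) : Fin m × Fin n → α :=
  fun x => A (i + ((x.1 : ℕ) : ZMod M)) (j + ((x.2 : ℕ) : ZMod N))

/-- A doubly periodic `M × N` array is an `(m, n, R)`-de Bruijn covering array if the set of all its
`m × n` windows is a covering code of radius `R`. -/
def IsDeBruijnCoveringArray {M N : ℕ} {α : Type*} [DecidableEq α] (A : ZMod M → ZMod N → α)
    (m n R : ℕ) : Prop :=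
  IsCoveringCode {w | ∃ (i : ZMod M) (j : ZMod N), w = arrayWindow A m n i j} R

/-!
Write `l = m * n` and `V = V_q(l, R)`. The array is assembled from tiles with `h = min M (2 * m)` rows
and `2 * n` columns, of area at most `4 * l`. Each tile has `l` windows (`tileWindow`) that pairwise
disagree at every position: no cell of the tile is at the same position of two windows.

For a random tile, a fixed word is near `μ = l * V / q ^ l` windows on average. Windows overlap, so
these events are dependent, and for some words (such as constant ones with `h = m`, where windows
differ by a rotation) heavily so. Averaged over all words the dependence is negligible: if a word is
near two windows then these are within `2 * R` of each other, and as they disagree at every position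
one can find `t = ⌈l / 3⌉` positions where the comparison is between independent uniform letters
(`card_hammingDist_comp_le`), so this has probability at most `V_q(t, 2 * R) / q ^ t`. Bonferroni's
inequality then yields a tile covering a proportion close to `μ` of any set of words that is not
exponentially small (`exists_tile_covering`).

Taking `O(log l / μ)` tiles greedily (`exists_tiles_card_uncovered_le`), of total area
`O(q ^ l / V * log l)`, leaves a proportion `l ^ (-(R + 1))` of the words, plus an exponentially small
one. Since `V = O(l ^ R)`, even giving each remaining word a tile of its own costs only
`O(q ^ l / V)`. Stacking the tiles in strips of `M` rows (`exists_array_of_tiles`) wastes at most a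
constant factor and one strip, of area `2 * M * n`.
-/

/-! ### Counting words -/

open Finset in
theorem card_hammingBall {ι α : Type*} [Fintype ι] [DecidableEq ι] [Fintype α]
    [DecidableEq α] (w : ι → α) (R : ℕ) :
    #{u : ι → α | hammingDist w u ≤ R} = ballVolume (Fintype.card α) (Fintype.card ι) R := by
  classical
  have sphere (D : Finset ι) :
      #{u : ι → α | ({i | w i ≠ u i} : Finset ι) = D} = (Fintype.card α - 1) ^ #D := by
    have : ({u : ι → α | ({i | w i ≠ u i} : Finset ι) = D} : Finset (ι → α)) =
        Fintype.piFinset fun i => if i ∈ D then univ.erase (w i) else {w i} := by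
      ext u
      simp only [mem_filter, mem_univ, true_and, Fintype.mem_piFinset, Finset.ext_iff]
      refine forall_congr' fun i => ?_
      by_cases hi : i ∈ D <;> simp [hi, eq_comm]
    rw [this, Fintype.card_piFinset]
    simp [apply_ite Finset.card]
  rw [card_eq_sum_card_fiberwise (f := fun u => ({i | w i ≠ u i} : Finset ι))
    (t := {D : Finset ι | #D ≤ R}) (fun u hu => by simpa [hammingDist] using hu)]
  have (D : Finset ι) (hD : D ∈ ({D : Finset ι | #D ≤ R} : Finset (Finset ι))) :
      #{u ∈ ({u : ι → α | hammingDist w u ≤ R} : Finset (ι → α)) |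
        ({i | w i ≠ u i} : Finset ι) = D} = (Fintype.card α - 1) ^ #D := by
    rw [← sphere D, filter_filter]
    congr 1
    ext u
    simp only [mem_filter, mem_univ, true_and] at hD ⊢
    exact ⟨fun h => h.2, fun h => ⟨by rw [hammingDist, h]; exact hD, h⟩⟩
  rw [sum_congr rfl this, ballVolume,
    ← sum_fiberwise_of_maps_to (g := Finset.card) (t := range (R + 1))
      (fun D hD => by simpa [Nat.lt_succ_iff] using hD)]
  refine sum_congr rfl fun i hi => ?_
  rw [sum_congr rfl (g := fun _ => (Fintype.card α - 1) ^ i)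
    (fun D hD => by rw [(mem_filter.1 hD).2]), sum_const, smul_eq_mul]
  congr 1
  rw [← card_univ (α := ι), ← card_powersetCard]
  congr 1
  ext D
  simp only [mem_filter, mem_univ, true_and, mem_powersetCard, subset_univ, and_iff_right_iff_imp]
  rintro rfl
  exact Nat.lt_succ_iff.1 (mem_range.1 hi)

open Finset in
/-- Restricting a uniformly random word along an injection gives a uniformly random word. -/
theorem card_filter_comp {ι κ α : Type*} [Fintype ι] [Fintype κ] [Fintype α] [DecidableEq ι]
    [DecidableEq κ] {f : ι → κ} (hf : f.Injective) (P : (ι → α) → Prop) [DecidablePred P] :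
    #{x : κ → α | P (x ∘ f)} * Fintype.card α ^ Fintype.card ι =
      #{u : ι → α | P u} * Fintype.card α ^ Fintype.card κ := by
  classical
  have fiber (u : ι → α) : #{x : κ → α | x ∘ f = u} * Fintype.card α ^ Fintype.card ι =
      Fintype.card α ^ Fintype.card κ := by
    have : ({x : κ → α | x ∘ f = u} : Finset (κ → α)) =
        Fintype.piFinset fun k => ({a | ∀ i, f i = k → a = u i} : Finset α) := by
      ext x
      simp only [mem_filter, mem_univ, true_and, Fintype.mem_piFinset, funext_iff]
      exact ⟨fun h k i hi => hi ▸ h i, fun h i => h _ i rfl⟩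
    rw [this, Fintype.card_piFinset, ← prod_mul_prod_compl (univ.image f)]
    have h1 : ∏ k ∈ univ.image f, #{a | ∀ i, f i = k → a = u i} = 1 := by
      refine prod_eq_one fun k hk => ?_
      obtain ⟨i, -, rfl⟩ := mem_image.1 hk
      rw [card_eq_one]
      refine ⟨u i, ?_⟩
      ext a
      simp only [mem_filter, mem_univ, true_and, mem_singleton]
      exact ⟨fun h => h i rfl, fun h j hj => by rw [h, hf hj]⟩
    have h2 : ∏ k ∈ (univ.image f)ᶜ, #{a | ∀ i, f i = k → a = u i} =
        Fintype.card α ^ (Fintype.card κ - Fintype.card ι) := by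
      rw [prod_congr rfl (g := fun _ => Fintype.card α), prod_const, card_compl,
        card_image_of_injective _ hf, card_univ]
      intro k hk
      rw [← card_univ]
      congr 1
      refine filter_true_of_mem fun a _ i hi => ?_
      simp [← hi] at hk
    rw [h1, h2, one_mul, ← pow_add, Nat.sub_add_cancel (Fintype.card_le_of_injective f hf)]
  rw [card_eq_sum_card_fiberwise (f := fun x => x ∘ f) (t := {u : ι → α | P u})
    (fun x hx => by simpa using hx), sum_mul, sum_congr rfl
    (g := fun _ => Fintype.card α ^ Fintype.card κ), sum_const, smul_eq_mul]
  intro u hu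
  rw [← fiber u, filter_filter]
  congr 2
  ext x
  simp only [mem_filter, mem_univ, true_and] at hu ⊢
  exact ⟨fun h => h.2, fun h => ⟨by rw [h]; exact hu, h⟩⟩

open Finset in
/-- The graph on `ι` joining `p` to `p'` when `f p = g p'` has no loops and maximum degree at most
`2`, so a maximal independent set has at least a third of the vertices. -/
theorem exists_card_eq_image_disjoint {ι κ : Type*} [Fintype ι] [DecidableEq ι] [DecidableEq κ]
    {f g : ι → κ} (hf : f.Injective) (hg : g.Injective) (hfg : ∀ p, f p ≠ g p) :
    ∃ T : Finset ι, #T = (Fintype.card ι + 2) / 3 ∧ ∀ p ∈ T, ∀ p' ∈ T, f p ≠ g p' := by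
  obtain ⟨T, hT⟩ := Set.Finite.exists_maximal
    (Set.toFinite {T : Finset ι | ∀ p ∈ T, ∀ p' ∈ T, f p ≠ g p'}) ⟨∅, by simp⟩
  have hcover : (univ : Finset ι) ⊆
      T ∪ (({p | f p ∈ T.image g} : Finset ι) ∪ ({p | g p ∈ T.image f} : Finset ι)) := by
    intro p _
    by_contra hp
    simp only [mem_union, mem_filter, mem_univ, true_and, mem_image, not_or, not_exists,
      not_and] at hp
    refine hp.1 (hT.2 (y := insert p T) ?_ (subset_insert p T) (mem_insert_self p T))
    intro a ha b hb
    rcases mem_insert.1 ha with rfl | ha' <;>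
      rcases mem_insert.1 hb with rfl | hb'
    · exact hfg _
    · exact fun h => hp.2.1 b hb' h.symm
    · exact fun h => hp.2.2 a ha' h
    · exact hT.1 a ha' b hb'
  have h1 : #{p | f p ∈ T.image g} ≤ #T :=
    (card_le_card_of_injOn f (fun p hp => by simpa using hp) hf.injOn).trans card_image_le
  have h2 : #{p | g p ∈ T.image f} ≤ #T :=
    (card_le_card_of_injOn g (fun p hp => by simpa using hp) hg.injOn).trans card_image_le
  have h3 := (card_le_card hcover).trans ((card_union_le _ _).trans
    (Nat.add_le_add_left (card_union_le _ _) _))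
  rw [card_univ] at h3
  obtain ⟨T', hT', hcard⟩ := exists_subset_card_eq (s := T) (n := (Fintype.card ι + 2) / 3)
    (by omega)
  exact ⟨T', hcard, fun p hp p' hp' => hT.1 p (hT' hp) p' (hT' hp')⟩

open Finset in
/-- Two windows of a random array that disagree at every position, even if they share cells, are
rarely close to each other: with `t = ⌈|ι| / 3⌉`, they are within distance `r` for a proportion at most
`V_q(t, r) / q ^ t` of all arrays. -/
theorem card_hammingDist_comp_le {ι κ α : Type*} [Fintype ι] [Fintype κ] [Fintype α]
    [DecidableEq ι] [DecidableEq κ] [DecidableEq α] [AddGroup α] {f g : ι → κ}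
    (hf : f.Injective) (hg : g.Injective) (hfg : ∀ p, f p ≠ g p) (r : ℕ) :
    #{x : κ → α | hammingDist (x ∘ f) (x ∘ g) ≤ r} *
        Fintype.card α ^ ((Fintype.card ι + 2) / 3) ≤
      ballVolume (Fintype.card α) ((Fintype.card ι + 2) / 3) r *
        Fintype.card α ^ Fintype.card κ := by
  classical
  obtain ⟨T, hT, hTd⟩ := exists_card_eq_image_disjoint hf hg hfg
  have hfT : Function.Injective fun p : T => f p := hf.comp Subtype.val_injective
  have key := card_filter_comp (α := α) hfT fun u => hammingDist 0 u ≤ r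
  rw [card_hammingBall, Fintype.card_coe, hT] at key
  refine le_trans (Nat.mul_le_mul_right _ ?_) key.le
  -- The shear subtracts `x (g p)` from `x (f p)` for `p ∈ T`; it is injective since no `g p` is
  -- altered.
  let shear (x : κ → α) (k : κ) : α := if h : ∃ p ∈ T, f p = k then x k - x (g h.choose) else x k
  have shear_f (x : κ → α) (p : ι) (hp : p ∈ T) : shear x (f p) = x (f p) - x (g p) := by
    have h : ∃ p' ∈ T, f p' = f p := ⟨p, hp, rfl⟩
    simp only [shear, dif_pos h]
    rw [hf h.choose_spec.2]
  have shear_g (x : κ → α) (p : ι) (hp : p ∈ T) : shear x (g p) = x (g p) :=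
    dif_neg fun ⟨p', hp', h⟩ => hTd p' hp' p hp h
  refine card_le_card_of_injOn shear (fun x hx => ?_) fun x _ y _ hxy => ?_
  · simp only [coe_filter, mem_univ, true_and, Set.mem_ofPred_eq] at hx ⊢
    refine le_trans ?_ hx
    refine card_le_card_of_injOn Subtype.val (fun p hp => ?_) Subtype.val_injective.injOn
    simp only [coe_filter, mem_univ, true_and, Set.mem_ofPred_eq, Function.comp_apply,
      shear_f x p p.2, Pi.zero_apply, ne_eq] at hp ⊢
    exact fun h => hp (by rw [h, sub_self])
  · funext k
    have hk := congrFun hxy k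
    by_cases h : ∃ p ∈ T, f p = k
    · obtain ⟨p, hp, rfl⟩ := h
      have hgp := congrFun hxy (g p)
      rw [shear_g x p hp, shear_g y p hp] at hgp
      rw [shear_f x p hp, shear_f y p hp, hgp] at hk
      exact sub_left_injective hk
    · simpa only [shear, dif_neg h] using hk

/-! ### A tile covering many words -/

open Finset in
/-- Some tile covers many of the words of `U`: about `μ * |U|`, where
`μ = |S| * V_q(|W|, R) / q ^ |W|` is the expected number of windows of a random tile near a fixed
word. The subtracted term accounts for words that are near several windows of one tile. It is uniform
in `U` because the sum over `U` of the numbers of tiles with two given windows near a word is at most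
the sum over all words. -/
theorem exists_tile_covering {S W X α : Type*} [Fintype S] [Fintype W] [Fintype X] [Fintype α]
    [DecidableEq S] [DecidableEq W] [DecidableEq X] [DecidableEq α] [AddGroup α] {φ : S → W → X}
    (hφ : ∀ s, (φ s).Injective) (hne : ∀ s s', s ≠ s' → ∀ p, φ s p ≠ φ s' p)
    (R : ℕ) (U : Finset (W → α)) :
    ∃ x : X → α,
      Fintype.card S * ballVolume (Fintype.card α) (Fintype.card W) R /
          (Fintype.card α : ℝ) ^ Fintype.card W *
        (#U - Fintype.card S *
          (ballVolume (Fintype.card α) ((Fintype.card W + 2) / 3) (2 * R) *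
            (Fintype.card α : ℝ) ^ Fintype.card W /
              (Fintype.card α : ℝ) ^ ((Fintype.card W + 2) / 3))) ≤
        #{w ∈ U | ∃ s, hammingDist w (x ∘ φ s) ≤ R} := by
  classical
  have hα : 0 < Fintype.card α := Fintype.card_pos
  set q := Fintype.card α
  set l := Fintype.card W
  set t := (l + 2) / 3
  set V := ballVolume q l R
  set V' := ballVolume q t (2 * R)
  have hq : (0 : ℝ) < q := by exact_mod_cast hα
  have hX : (0 : ℝ) < (q : ℝ) ^ Fintype.card X := by positivity
  let near (x : X → α) (w : W → α) (s : S) : Prop := hammingDist w (x ∘ φ s) ≤ R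
  -- Bonferroni: the number of windows near `w` is at most the indicator that one exists plus the
  -- number of ordered pairs of distinct windows near `w`.
  have bonferroni (x : X → α) (w : W → α) : #{s | near x w s} ≤
      (if ∃ s, near x w s then 1 else 0) +
        #{z ∈ (univ : Finset S).offDiag | near x w z.1 ∧ near x w z.2} := by
    have : ({z ∈ (univ : Finset S).offDiag | near x w z.1 ∧ near x w z.2} : Finset (S × S)) =
        ({s | near x w s} : Finset S).offDiag := by
      ext z
      simp only [mem_filter, mem_offDiag, mem_univ, true_and]
      tauto
    rw [this, offDiag_card]
    split_ifs with h
    · rcases Nat.lt_or_ge #{s | near x w s} 2 with h2 | h2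
      · omega
      · have := Nat.mul_le_mul_right #{s | near x w s} h2
        omega
    · have : #{s | near x w s} = 0 := by
        rw [card_eq_zero, filter_eq_empty_iff]
        exact fun s _ hs => h ⟨s, hs⟩
      omega
  have single (w : W → α) (s : S) : (#{x : X → α | near x w s} : ℝ) =
      V * (q : ℝ) ^ Fintype.card X / (q : ℝ) ^ l := by
    have := card_filter_comp (α := α) (hφ s) fun u => hammingDist w u ≤ R
    rw [card_hammingBall] at this
    rw [eq_div_iff (by positivity)]
    exact_mod_cast this
  have pair (z : S × S) (hz : z ∈ (univ : Finset S).offDiag) :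
      ∑ x : X → α, (#{w ∈ U | near x w z.1 ∧ near x w z.2} : ℝ) ≤
        V * (V' * (q : ℝ) ^ Fintype.card X / (q : ℝ) ^ t) := by
    have h1 (x : X → α) : (#{w ∈ U | near x w z.1 ∧ near x w z.2} : ℝ) ≤
        if hammingDist (x ∘ φ z.1) (x ∘ φ z.2) ≤ 2 * R then (V : ℝ) else 0 := by
      split_ifs with h
      · have hV : #{u : W → α | hammingDist (x ∘ φ z.1) u ≤ R} = V := card_hammingBall _ R
        rw [← hV]
        refine Nat.cast_le.2 (card_le_card fun w hw => ?_)
        simp only [mem_filter, mem_univ, true_and, near] at hw ⊢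
        rw [hammingDist_comm]
        exact hw.2.1
      · refine (Nat.cast_eq_zero.2 (card_eq_zero.2 (filter_eq_empty_iff.2 fun w _ hw => h ?_))).le
        have := hammingDist_triangle_left (x ∘ φ z.1) (x ∘ φ z.2) w
        have h1 := hw.1
        have h2 := hw.2
        simp only [near] at h1 h2
        omega
    refine (sum_le_sum fun x _ => h1 x).trans ?_
    rw [← sum_filter, sum_const, nsmul_eq_mul, mul_comm]
    refine mul_le_mul_of_nonneg_left ?_ (Nat.cast_nonneg _)
    rw [le_div_iff₀ (by positivity)]
    exact_mod_cast card_hammingDist_comp_le (α := α) (hφ z.1) (hφ z.2)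
      (hne _ _ (mem_offDiag.1 hz).2.2) (2 * R)
  have lower : ∑ x : X → α, ∑ w ∈ U, (#{s | near x w s} : ℝ) =
      #U * (Fintype.card S * (V * (q : ℝ) ^ Fintype.card X / (q : ℝ) ^ l)) := by
    rw [sum_comm, ← nsmul_eq_mul, ← sum_const]
    refine sum_congr rfl fun w _ => ?_
    have : ∑ x : X → α, (#{s | near x w s} : ℝ) = ∑ s, (#{x : X → α | near x w s} : ℝ) := by
      exact_mod_cast sum_card_bipartiteAbove_eq_sum_card_bipartiteBelow (s := univ) (t := univ)
        (fun (x : X → α) (s : S) => near x w s)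
    rw [this, sum_congr rfl fun s _ => single w s, sum_const, nsmul_eq_mul, card_univ]
  have upper : ∑ x : X → α, ∑ w ∈ U,
      (#{z ∈ (univ : Finset S).offDiag | near x w z.1 ∧ near x w z.2} : ℝ) ≤
      Fintype.card S * Fintype.card S * (V * (V' * (q : ℝ) ^ Fintype.card X / (q : ℝ) ^ t)) := by
    have h1 (x : X → α) : ∑ w ∈ U,
        (#{z ∈ (univ : Finset S).offDiag | near x w z.1 ∧ near x w z.2} : ℝ) =
        ∑ z ∈ (univ : Finset S).offDiag, (#{w ∈ U | near x w z.1 ∧ near x w z.2} : ℝ) := by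
      exact_mod_cast sum_card_bipartiteAbove_eq_sum_card_bipartiteBelow (s := U)
        (t := (univ : Finset S).offDiag) (fun w z => near x w z.1 ∧ near x w z.2)
    rw [sum_congr rfl fun x _ => h1 x, sum_comm]
    refine (sum_le_sum pair).trans ?_
    rw [sum_const, nsmul_eq_mul, offDiag_card, card_univ]
    refine mul_le_mul_of_nonneg_right ?_ (by positivity)
    exact_mod_cast Nat.sub_le _ _
  by_contra! hcon
  have hsum := sum_lt_sum_of_nonempty (s := (univ : Finset (X → α))) univ_nonempty
    fun x _ => hcon x
  rw [sum_const, nsmul_eq_mul, card_univ, Fintype.card_fun] at hsum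
  have total : ∑ x : X → α, ∑ w ∈ U, (#{s | near x w s} : ℝ) ≤
      ∑ x : X → α, (#{w ∈ U | ∃ s, near x w s} : ℝ) + ∑ x : X → α, ∑ w ∈ U,
        (#{z ∈ (univ : Finset S).offDiag | near x w z.1 ∧ near x w z.2} : ℝ) := by
    rw [← sum_add_distrib]
    refine sum_le_sum fun x _ => ?_
    rw [card_filter, Nat.cast_sum, ← sum_add_distrib]
    refine sum_le_sum fun w _ => ?_
    exact_mod_cast bonferroni x w
  have e : ((q ^ Fintype.card X : ℕ) : ℝ) * (Fintype.card S * V / (q : ℝ) ^ l *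
      (#U - Fintype.card S * (V' * (q : ℝ) ^ l / (q : ℝ) ^ t))) =
      #U * (Fintype.card S * (V * (q : ℝ) ^ Fintype.card X / (q : ℝ) ^ l)) -
      Fintype.card S * Fintype.card S * (V * (V' * (q : ℝ) ^ Fintype.card X / (q : ℝ) ^ t)) := by
    push_cast
    field_simp
  rw [show Fintype.card α = q from rfl, e] at hsum
  simp only [near] at total lower upper
  linarith

/-! ### Greedy choice of tiles -/

open Finset in
/-- Greedy iteration of `exists_tile_covering`: each further tile multiplies the excess of the
number of uncovered words over `b` by at most `1 - μ ≤ exp (-μ)`. -/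
theorem exists_tiles_card_uncovered_le {S W X α : Type*} [Fintype S] [Fintype W] [Fintype X]
    [Fintype α] [DecidableEq S] [DecidableEq W] [DecidableEq X] [DecidableEq α] [AddGroup α]
    {φ : S → W → X} (hφ : ∀ s, (φ s).Injective) (hne : ∀ s s', s ≠ s' → ∀ p, φ s p ≠ φ s' p)
    (R : ℕ) {μ b : ℝ}
    (hμ : μ = Fintype.card S * ballVolume (Fintype.card α) (Fintype.card W) R /
      (Fintype.card α : ℝ) ^ Fintype.card W)
    (hb : b = Fintype.card S * (ballVolume (Fintype.card α) ((Fintype.card W + 2) / 3) (2 * R) *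
      (Fintype.card α : ℝ) ^ Fintype.card W /
        (Fintype.card α : ℝ) ^ ((Fintype.card W + 2) / 3))) (k : ℕ) :
    ∃ x : ℕ → X → α,
      (#{w : W → α | ∀ τ < k, ∀ s, R < hammingDist w (x τ ∘ φ s)} : ℝ) ≤
        b + Real.exp (-μ * k) * (Fintype.card α : ℝ) ^ Fintype.card W := by
  classical
  have hb0 : 0 ≤ b := by rw [hb]; positivity
  induction k with
  | zero =>
    refine ⟨fun _ _ => 0, ?_⟩
    have : (#{w : W → α | ∀ τ < 0, ∀ s, R < hammingDist w ((fun _ => 0 : X → α) ∘ φ s)} : ℝ) ≤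
        Fintype.card (W → α) := by exact_mod_cast card_le_univ _
    refine this.trans ?_
    rw [Fintype.card_fun]
    push_cast
    simpa using hb0
  | succ k ih =>
    obtain ⟨x, hx⟩ := ih
    set U : Finset (W → α) := {w | ∀ τ < k, ∀ s, R < hammingDist w (x τ ∘ φ s)} with hU
    obtain ⟨y, hy⟩ := exists_tile_covering hφ hne R U
    rw [← hμ, ← hb] at hy
    refine ⟨Function.update x k y, ?_⟩
    have hsub : ({w : W → α | ∀ τ < k + 1, ∀ s, R < hammingDist w (Function.update x k y τ ∘ φ s)} :
        Finset (W → α)) ⊆ {w ∈ U | ¬ ∃ s, hammingDist w (y ∘ φ s) ≤ R} := by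
      intro w hw
      simp only [hU, mem_filter, mem_univ, true_and, not_exists, not_le] at hw ⊢
      refine ⟨fun τ hτ s => ?_, fun s => ?_⟩
      · simpa [hτ.ne] using hw τ (hτ.trans k.lt_succ_self) s
      · simpa using hw k k.lt_succ_self s
    have hle : (#{w : W → α | ∀ τ < k + 1, ∀ s,
        R < hammingDist w (Function.update x k y τ ∘ φ s)} : ℝ) ≤
        #{w ∈ U | ¬ ∃ s, hammingDist w (y ∘ φ s) ≤ R} := by exact_mod_cast card_le_card hsub
    have hsplit : (#{w ∈ U | ∃ s, hammingDist w (y ∘ φ s) ≤ R} : ℝ) +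
        #{w ∈ U | ¬ ∃ s, hammingDist w (y ∘ φ s) ≤ R} = #U := by
      exact_mod_cast card_filter_add_card_filter_not (s := U) _
    refine hle.trans ?_
    have hq : (0 : ℝ) ≤ (Fintype.card α : ℝ) ^ Fintype.card W := by positivity
    rcases le_total (#U : ℝ) b with hUb | hUb
    · have : (0 : ℝ) ≤ #{w ∈ U | ∃ s, hammingDist w (y ∘ φ s) ≤ R} := Nat.cast_nonneg _
      have : 0 ≤ Real.exp (-μ * (k + 1 : ℕ)) * (Fintype.card α : ℝ) ^ Fintype.card W := by
        positivity
      linarith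
    · have e : Real.exp (-μ * (k + 1 : ℕ)) = Real.exp (-μ) * Real.exp (-μ * k) := by
        rw [← Real.exp_add]; push_cast; ring_nf
      have h1 : (1 - μ) * (#U - b) ≤ Real.exp (-μ) * (#U - b) :=
        mul_le_mul_of_nonneg_right (by linarith [Real.add_one_le_exp (-μ)]) (by linarith)
      have h2 : Real.exp (-μ) * (#U - b) ≤ Real.exp (-μ) * (Real.exp (-μ * k) *
          (Fintype.card α : ℝ) ^ Fintype.card W) :=
        mul_le_mul_of_nonneg_left (by linarith) (Real.exp_pos _).le
      rw [e]
      linarith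

/-! ### Laying out tiles in a doubly periodic array -/

/-- The position, in an `h × 2n` tile with rows read modulo `h`, of the cell `p` of the `m × n`
window with upper-left corner `s`. -/
def tileWindow {m n h : ℕ} (hmh : m ≤ h) (s p : Fin m × Fin n) : Fin h × Fin (2 * n) :=
  (⟨(s.1 + p.1) % h, Nat.mod_lt _ (s.1.pos.trans_le hmh)⟩, ⟨s.2 + p.2, by omega⟩)

theorem add_mod_left_injOn {a b c h : ℕ} (ha : a < h) (hb : b < h)
    (H : (c + a) % h = (c + b) % h) : a = b := by
  have := Nat.ModEq.add_left_cancel' c (show c + a ≡ c + b [MOD h] from H)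
  rwa [Nat.ModEq, Nat.mod_eq_of_lt ha, Nat.mod_eq_of_lt hb] at this

theorem tileWindow_injective {m n h : ℕ} (hmh : m ≤ h) (s : Fin m × Fin n) :
    (tileWindow hmh s).Injective := by
  intro p p' H
  simp only [tileWindow, Prod.mk.injEq, Fin.mk.injEq] at H
  refine Prod.ext (Fin.ext ?_) (Fin.ext ?_)
  · exact add_mod_left_injOn (p.1.2.trans_le hmh) (p'.1.2.trans_le hmh) H.1
  · exact Nat.add_left_cancel H.2

theorem tileWindow_ne {m n h : ℕ} (hmh : m ≤ h) (s s' : Fin m × Fin n) (hs : s ≠ s')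
    (p : Fin m × Fin n) : tileWindow hmh s p ≠ tileWindow hmh s' p := by
  intro H
  simp only [tileWindow, Prod.mk.injEq, Fin.mk.injEq] at H
  refine hs (Prod.ext (Fin.ext ?_) (Fin.ext ?_))
  · refine add_mod_left_injOn (c := p.1) (s.1.2.trans_le hmh) (s'.1.2.trans_le hmh) ?_
    rw [add_comm, H.1, add_comm]
  · exact Nat.add_right_cancel H.2

/-- The tiles are stacked in the array, `M / h` of them in each strip of `2 * n` columns, tile `τ` in
row `τ % (M / h)` and column `τ / (M / h)` of the stack. The choice of `h` makes every window of a tile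
a window of the array: either the rows of the tile wrap around with those of the array (`h = M`), or
no window of the tile wraps around (`h = 2 * m`). -/
theorem exists_array_of_tiles {α : Type*} [DecidableEq α] {m n M h R T : ℕ} (hm : 1 ≤ m)
    (hn : 1 ≤ n) (hh : h = min M (2 * m)) (hmh : m ≤ h)
    (x : ℕ → Fin h × Fin (2 * n) → α)
    (hx : ∀ w : Fin m × Fin n → α, ∃ τ < T, ∃ s, hammingDist w (x τ ∘ tileWindow hmh s) ≤ R) :
    ∃ N : ℕ, n ≤ N ∧ (∃ A : ZMod M → ZMod N → α, IsDeBruijnCoveringArray A m n R) ∧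
      M * N ≤ 8 * (m * n) * T + 2 * (M * n) := by
  have hhM : h ≤ M := by omega
  have hh0 : 0 < h := by omega
  set k := M / h with hk
  have hk0 : 0 < k := Nat.div_pos hhM hh0
  have hkM : h * k ≤ M := Nat.mul_div_le M h
  have hMk : M < 2 * (h * k) := by
    have h1 : M < h * (k + 1) := Nat.lt_mul_div_succ M hh0
    have h2 : h * 1 ≤ h * k := Nat.mul_le_mul_left h hk0
    rw [mul_add] at h1
    omega
  have : NeZero M := ⟨by omega⟩
  set N := 2 * n * (T / k + 1) with hN
  have : NeZero N := ⟨by positivity⟩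
  refine ⟨N, by rw [hN]; nlinarith [Nat.zero_le (T / k)], ⟨fun r c =>
    x (r.val / h + k * (c.val / (2 * n))) (⟨r.val % h, Nat.mod_lt _ hh0⟩,
      ⟨c.val % (2 * n), Nat.mod_lt _ (by omega)⟩), fun w => ?_⟩, ?_⟩
  · obtain ⟨τ, hτ, s, hs⟩ := hx w
    refine ⟨_, ⟨((h * (τ % k) + s.1 : ℕ) : ZMod M), ((2 * n * (τ / k) + s.2 : ℕ) : ZMod N), rfl⟩,
      ?_⟩
    convert hs using 2
    funext p
    have hrow : ((h * (τ % k) + s.1 + p.1 : ℕ) : ZMod M).val / h = τ % k ∧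
        ((h * (τ % k) + s.1 + p.1 : ℕ) : ZMod M).val % h = (s.1 + p.1) % h := by
      rw [ZMod.val_natCast]
      have hs1 := s.1.2
      have hp1 := p.1.2
      rcases lt_or_ge M (2 * m) with hM | hM
      · -- A single tile fills the rows, and its cyclic windows are those of the array.
        have hhM' : h = M := by omega
        have hk1 : k = 1 := by rw [hk, hhM', Nat.div_self (by omega)]
        rw [hk1, Nat.mod_one, mul_zero, zero_add, ← hhM', Nat.mod_mod]
        exact ⟨Nat.div_eq_of_lt (Nat.mod_lt _ hh0), rfl⟩
      · -- No window wraps around, neither in the tile nor in the array.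
        have hlt : s.1 + p.1 < h := by omega
        have hrk : h * (τ % k + 1) ≤ h * k := Nat.mul_le_mul_left h (Nat.mod_lt τ hk0)
        rw [mul_add] at hrk
        rw [Nat.mod_eq_of_lt (by omega), add_assoc, Nat.mul_add_div hh0, Nat.mul_add_mod,
          Nat.div_eq_of_lt hlt]
        exact ⟨rfl, rfl⟩
    have hcol : ((2 * n * (τ / k) + s.2 + p.2 : ℕ) : ZMod N).val / (2 * n) = τ / k ∧
        ((2 * n * (τ / k) + s.2 + p.2 : ℕ) : ZMod N).val % (2 * n) = s.2 + p.2 := by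
      have hlt : s.2 + p.2 < 2 * n := by omega
      have h1 : 2 * n * (τ / k) ≤ 2 * n * (T / k) :=
        Nat.mul_le_mul_left _ (Nat.div_le_div_right hτ.le)
      rw [ZMod.val_natCast, Nat.mod_eq_of_lt (by rw [hN, mul_add]; omega), add_assoc,
        Nat.mul_add_div (by omega), Nat.mul_add_mod, Nat.div_eq_of_lt hlt, Nat.mod_eq_of_lt hlt]
      exact ⟨rfl, rfl⟩
    simp only [arrayWindow, ← Nat.cast_add, Function.comp_apply, tileWindow, hrow.1, hrow.2,
      hcol.1, hcol.2, Nat.mod_add_div]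
  · have h1 : k * (T / k) ≤ T := Nat.mul_div_le T k
    have h2 : M * (T / k) ≤ 4 * m * T := by
      calc M * (T / k) ≤ 2 * (h * k) * (T / k) := Nat.mul_le_mul_right _ hMk.le
        _ = 2 * h * (k * (T / k)) := by ring
        _ ≤ 2 * (2 * m) * T := by gcongr; omega
        _ = 4 * m * T := by ring
    calc M * N = 2 * n * (M * (T / k)) + 2 * (M * n) := by rw [hN]; ring
      _ ≤ 2 * n * (4 * m * T) + 2 * (M * n) := by gcongr
      _ = 8 * (m * n) * T + 2 * (M * n) := by ring

open Finset in
/-- Tiles that miss only `u` words can be completed to a covering family by one further tile for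
each missed word, holding that word as a window. -/
theorem exists_array_of_tiles_of_card_uncovered {α : Type*} [Fintype α] [DecidableEq α]
    {m n M h R : ℕ} (hm : 1 ≤ m) (hn : 1 ≤ n) (hh : h = min M (2 * m)) (hmh : m ≤ h) (k : ℕ)
    (x : ℕ → Fin h × Fin (2 * n) → α) :
    ∃ N : ℕ, n ≤ N ∧ (∃ A : ZMod M → ZMod N → α, IsDeBruijnCoveringArray A m n R) ∧
      M * N ≤ 8 * (m * n) * (k + #{w : Fin m × Fin n → α | ∀ τ < k, ∀ s,
        R < hammingDist w (x τ ∘ tileWindow hmh s)}) + 2 * (M * n) := by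
  classical
  set U : Finset (Fin m × Fin n → α) :=
    {w | ∀ τ < k, ∀ s, R < hammingDist w (x τ ∘ tileWindow hmh s)} with hU
  let s₀ : Fin m × Fin n := (⟨0, hm⟩, ⟨0, hn⟩)
  let e := U.equivFin
  refine exists_array_of_tiles hm hn hh hmh (fun τ => if τ < k then x τ else
    if hτ : τ - k < #U then
      Function.extend (tileWindow hmh s₀) (e.symm ⟨τ - k, hτ⟩).1 (x 0) else x 0) fun w => ?_
  by_cases hw : w ∈ U
  · refine ⟨k + e ⟨w, hw⟩, by omega, s₀, ?_⟩
    have : ¬ (k + (e ⟨w, hw⟩ : ℕ) < k) := by omega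
    simp [this, Function.extend_comp (tileWindow_injective hmh s₀)]
  · simp only [hU, mem_filter, mem_univ, true_and, not_forall, not_lt] at hw
    obtain ⟨τ, hτ, s, hs⟩ := hw
    exact ⟨τ, by omega, s, by simpa [hτ] using hs⟩

/-! ### Estimates -/

theorem one_le_ballVolume (q n R : ℕ) : 1 ≤ ballVolume q n R := by
  rw [ballVolume, Finset.sum_range_succ']
  simp

theorem ballVolume_le {q n : ℕ} (hq : 1 ≤ q) (hn : 1 ≤ n) (R : ℕ) :
    ballVolume q n R ≤ (R + 1) * (n * q) ^ R := by
  have : ∀ i ∈ Finset.range (R + 1), n.choose i * (q - 1) ^ i ≤ (n * q) ^ R := fun i hi => by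
    calc n.choose i * (q - 1) ^ i ≤ n ^ i * q ^ i :=
          Nat.mul_le_mul (Nat.choose_le_pow n i) (Nat.pow_le_pow_left (Nat.sub_le q 1) i)
      _ = (n * q) ^ i := (mul_pow _ _ _).symm
      _ ≤ (n * q) ^ R := by
        exact Nat.pow_le_pow_right (Nat.mul_pos hn hq) (Nat.lt_succ_iff.1 (Finset.mem_range.1 hi))
  simpa [ballVolume] using Finset.sum_le_card_nsmul _ _ _ this

theorem exists_pow_le_mul_two_pow (p : ℕ) : ∃ K : ℝ, 0 < K ∧ ∀ t : ℕ, (t : ℝ) ^ p ≤ K * 2 ^ t := by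
  obtain ⟨K, hK⟩ := (tendsto_pow_const_div_const_pow_of_one_lt p
    (one_lt_two (α := ℝ))).bddAbove_range
  refine ⟨max K 1, by positivity, fun t => ?_⟩
  rw [← div_le_iff₀ (by positivity)]
  exact (hK ⟨t, rfl⟩).trans (le_max_left _ _)

/-- The loss `b` in `exists_tiles_card_uncovered_le` is affordable: giving each of `b` words of length
`l` a tile of its own costs area `O(l * b)`, and this bound says `l * b = O(q ^ l / V_q(l, R))`. -/
theorem exists_overlap_bound (q R : ℕ) (hq : 2 ≤ q) : ∃ K : ℝ, 0 < K ∧ ∀ l : ℕ, 1 ≤ l →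
    (l : ℝ) ^ 2 * ballVolume q ((l + 2) / 3) (2 * R) * ballVolume q l R ≤
      K * (q : ℝ) ^ ((l + 2) / 3) := by
  obtain ⟨K, hK0, hK⟩ := exists_pow_le_mul_two_pow (2 + 2 * R + R)
  refine ⟨3 ^ 2 * ((2 * R + 1) * q ^ (2 * R)) * ((R + 1) * (3 * q) ^ R) * K, by positivity,
    fun l hl => ?_⟩
  set t := (l + 2) / 3
  have hlt : (l : ℝ) ≤ 3 * t := by
    have : l ≤ 3 * t := by omega
    exact_mod_cast this
  have h1 : (ballVolume q t (2 * R) : ℝ) ≤ (2 * R + 1) * (t * q) ^ (2 * R) := by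
    exact_mod_cast ballVolume_le (by omega) (by omega) (2 * R)
  have h2 : (ballVolume q l R : ℝ) ≤ (R + 1) * (3 * t * q) ^ R := by
    have : (ballVolume q l R : ℝ) ≤ (R + 1) * (l * q) ^ R := by
      exact_mod_cast ballVolume_le (by omega) hl R
    refine this.trans ?_
    gcongr
  calc (l : ℝ) ^ 2 * ballVolume q t (2 * R) * ballVolume q l R
      ≤ (3 * t) ^ 2 * ((2 * R + 1) * (t * q) ^ (2 * R)) * ((R + 1) * (3 * t * q) ^ R) := by gcongr
    _ = 3 ^ 2 * ((2 * R + 1) * q ^ (2 * R)) * ((R + 1) * (3 * q) ^ R) *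
          (t : ℝ) ^ (2 + 2 * R + R) := by
        simp only [mul_pow, pow_add]; ring
    _ ≤ 3 ^ 2 * ((2 * R + 1) * q ^ (2 * R)) * ((R + 1) * (3 * q) ^ R) * (K * 2 ^ t) := by
        gcongr; exact hK t
    _ ≤ 3 ^ 2 * ((2 * R + 1) * q ^ (2 * R)) * ((R + 1) * (3 * q) ^ R) * (K * q ^ t) := by
        gcongr; exact_mod_cast hq
    _ = _ := by ring

/-! ### The covering array -/

theorem theorem1 (q R : ℕ) (hq : 1 ≤ q) :
    ∃ C : ℝ, 0 < C ∧ ∀ m n M : ℕ, 1 ≤ m → 1 ≤ n → m ≤ M →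
      ∃ N : ℕ, n ≤ N ∧
        (∃ A : ZMod M → ZMod N → Fin q, IsDeBruijnCoveringArray A m n R) ∧
        (M : ℝ) * (N : ℝ) ≤
          C * max ((q : ℝ) ^ (m * n) / (ballVolume q (m * n) R : ℝ) *
                    (Real.log (m : ℝ) + Real.log (n : ℝ)))
                  ((M : ℝ) * (n : ℝ)) := by
  have : NeZero q := ⟨by omega⟩
  -- The overlap bound needs `q ≥ 2`, and is used only in that case.
  obtain ⟨K, hK0, hK⟩ := exists_overlap_bound (max q 2) R (le_max_right _ _)
  set B : ℝ := K + (R + 1) * q ^ R with hB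
  have hB0 : 0 < B := by positivity
  have hlog2 : 0 < Real.log 2 := Real.log_pos one_lt_two
  refine ⟨8 * q + 10 + 8 * (R + 1 + B / Real.log 2), by positivity, fun m n M hm hn hmM => ?_⟩
  have hmh : m ≤ min M (2 * m) := by omega
  have hl : 1 ≤ m * n := Nat.mul_pos hm hn
  have hlM : ((m * n : ℕ) : ℝ) ≤ M * n := by exact_mod_cast Nat.mul_le_mul_right n hmM
  have hm0 : (m : ℝ) ≠ 0 := by positivity
  have hn0 : (n : ℝ) ≠ 0 := by positivity
  have hV : (1 : ℝ) ≤ ballVolume q (m * n) R := by exact_mod_cast one_le_ballVolume q (m * n) R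
  have hq0 : (1 : ℝ) ≤ q := by exact_mod_cast hq
  rw [← Real.log_mul hm0 hn0, ← Nat.cast_mul]
  set l := m * n with hl_def
  set Q : ℝ := (q : ℝ) ^ l / ballVolume q l R with hQ
  have hQ0 : 0 < Q := by positivity
  set a := max (Q * Real.log l) (M * n : ℝ) with ha
  have ha1 : Q * Real.log l ≤ a := le_max_left _ _
  have ha2 : (M * n : ℝ) ≤ a := le_max_right _ _
  have hlog : 0 ≤ Real.log l := Real.log_natCast_nonneg l
  have ha0 : 0 ≤ a := le_trans (by positivity) ha2
  have hBl : 0 ≤ B / Real.log 2 := by positivity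
  -- `T` is the number of tiles.
  have finish {T : ℕ} (hT : (l * T : ℝ) ≤ (q + 1 + (R + 1 + B / Real.log 2)) * a)
      (hex : ∃ N : ℕ, n ≤ N ∧ (∃ A : ZMod M → ZMod N → Fin q, IsDeBruijnCoveringArray A m n R) ∧
        M * N ≤ 8 * l * T + 2 * (M * n)) :
      ∃ N : ℕ, n ≤ N ∧ (∃ A : ZMod M → ZMod N → Fin q, IsDeBruijnCoveringArray A m n R) ∧
        (M : ℝ) * N ≤ (8 * q + 10 + 8 * (R + 1 + B / Real.log 2)) * a := by
    obtain ⟨N, hN, hA, hMN⟩ := hex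
    refine ⟨N, hN, hA, ?_⟩
    have : (M * N : ℝ) ≤ 8 * l * T + 2 * (M * n) := by exact_mod_cast hMN
    linarith
  rcases (by omega : (q = 1 ∨ l = 1) ∨ (2 ≤ q ∧ 2 ≤ l)) with hsmall | ⟨hq2, hl2⟩
  · -- There are at most `q` words, and each gets its own tile.
    refine finish ?_ (exists_array_of_tiles_of_card_uncovered hm hn rfl hmh 0 fun _ _ => 0)
    have hcard : Fintype.card (Fin m × Fin n → Fin q) ≤ q := by
      rw [Fintype.card_fun, Fintype.card_prod, Fintype.card_fin, Fintype.card_fin,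
        Fintype.card_fin, ← hl_def]
      rcases hsmall with h | h <;> simp [h]
    have hT := (Finset.card_le_univ (Finset.univ.filter fun w : Fin m × Fin n → Fin q =>
      ∀ τ < 0, ∀ s, R < hammingDist w ((fun _ => 0) ∘ tileWindow hmh s))).trans hcard
    have hT' : (l : ℝ) * (0 + (Finset.univ.filter fun w : Fin m × Fin n → Fin q =>
      ∀ τ < 0, ∀ s, R < hammingDist w ((fun _ => 0) ∘ tileWindow hmh s)).card : ℕ) ≤ a * q := by
      rw [zero_add]
      exact mul_le_mul (hlM.trans ha2) (Nat.cast_le.2 hT) (by positivity) ha0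
    refine hT'.trans ?_
    have : 0 ≤ (1 + (R + 1 + B / Real.log 2)) * a := by positivity
    linarith
  · -- After `k = ⌈(R + 1) * log l / μ⌉` greedy tiles, where `μ = l / Q`, a proportion at most
    -- `l ^ (-(R + 1))` of the words remains, apart from the term bounded in `exists_overlap_bound`.
    obtain ⟨x, hx⟩ := exists_tiles_card_uncovered_le (α := Fin q) (tileWindow_injective hmh)
      (tileWindow_ne hmh) R rfl rfl ⌈(R + 1) * Real.log l * Q / l⌉₊
    simp only [Fintype.card_prod, Fintype.card_fin] at hx
    refine finish ?_ (exists_array_of_tiles_of_card_uncovered hm hn rfl hmh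
      ⌈(R + 1) * Real.log l * Q / l⌉₊ x)
    have hK := hK l hl
    rw [max_eq_left hq2] at hK
    set k := ⌈(R + 1) * Real.log l * Q / l⌉₊ with hk
    set t := (l + 2) / 3
    set V : ℝ := (ballVolume q l R : ℝ) with hVdef
    set V' : ℝ := (ballVolume q t (2 * R) : ℝ)
    have hl0 : (0 : ℝ) < l := by exact_mod_cast hl
    have hkl : (l * k : ℝ) ≤ (R + 1) * (Q * Real.log l) + l := by
      have := (Nat.ceil_lt_add_one
        (show 0 ≤ (R + 1) * Real.log l * Q / l by positivity)).le
      calc (l * k : ℝ) ≤ l * ((R + 1) * Real.log l * Q / l + 1) := by gcongr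
        _ = _ := by field_simp
    have hexp : Real.exp (-(l * V / (q : ℝ) ^ l) * k) ≤ ((l : ℝ) ^ (R + 1))⁻¹ := by
      rw [← Real.exp_log (show (0 : ℝ) < (l : ℝ) ^ (R + 1) by positivity), ← Real.exp_neg,
        Real.log_pow, Real.exp_le_exp, neg_mul, neg_le_neg_iff]
      calc ((R + 1 : ℕ) : ℝ) * Real.log l
          = l * V / (q : ℝ) ^ l * ((R + 1) * Real.log l * Q / l) := by
            rw [hQ]; push_cast; field_simp
        _ ≤ _ := by gcongr; exact Nat.le_ceil _
    have hb : (l : ℝ) * (l * (V' * (q : ℝ) ^ l / (q : ℝ) ^ t)) ≤ K * Q := by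
      calc (l : ℝ) * (l * (V' * (q : ℝ) ^ l / (q : ℝ) ^ t))
          = ((l : ℝ) ^ 2 * V' * V) / (q : ℝ) ^ t * Q := by rw [hQ]; field_simp
        _ ≤ K * Q := by
          refine mul_le_mul_of_nonneg_right ?_ hQ0.le
          rwa [div_le_iff₀ (by positivity)]
    have hrest : (l : ℝ) * (((l : ℝ) ^ (R + 1))⁻¹ * (q : ℝ) ^ l) ≤ (R + 1) * q ^ R * Q := by
      have hVle : V ≤ (R + 1) * (l * q) ^ R := by
        rw [hVdef]
        exact_mod_cast ballVolume_le hq hl R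
      calc (l : ℝ) * (((l : ℝ) ^ (R + 1))⁻¹ * (q : ℝ) ^ l) = V / (l : ℝ) ^ R * Q := by
            rw [hQ, pow_succ]; field_simp
        _ ≤ (R + 1) * q ^ R * Q := by
          refine mul_le_mul_of_nonneg_right ?_ hQ0.le
          rw [div_le_iff₀ (by positivity)]
          refine hVle.trans_eq ?_
          rw [mul_pow]; ring
    have hQa : B * Q ≤ B / Real.log 2 * a := by
      have : Real.log 2 ≤ Real.log l := Real.log_le_log two_pos (by exact_mod_cast hl2)
      calc B * Q = B / Real.log 2 * (Q * Real.log 2) := by field_simp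
        _ ≤ B / Real.log 2 * (Q * Real.log l) := by gcongr
        _ ≤ B / Real.log 2 * a := by gcongr
    have hU := mul_le_mul_of_nonneg_left hx hl0.le
    have hU2 : (l : ℝ) * (Real.exp (-(l * V / (q : ℝ) ^ l) * k) * (q : ℝ) ^ l) ≤
        l * (((l : ℝ) ^ (R + 1))⁻¹ * (q : ℝ) ^ l) := by gcongr
    have hR : (R + 1) * (Q * Real.log l) ≤ (R + 1) * a := by gcongr
    have hqa : 0 ≤ q * a := by positivity
    rw [hB] at hQa
    rw [Nat.cast_add]
    linarith
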